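/- Let $\mathcal A$ be a Desargues affine plane, that is, an incidence plane of points and lines in which (i) two distinct points lie on exactly one line, (ii) through a point not on a line $\ell$ there is exactly one line that does not meet $\ell$, (iii) there are three non-collinear points, and (iv) the affine Desargues axiom holds (for three distinct lines $AA',BB',CC'$ that are parallel or pass through one point: if $AB\parallel A'B'$ and $BC\parallel B'C'$, then $AC\parallel A'C'$; parallel lines are equal or disjoint). Let $O\neq I$ be two points and $\ell^{OI}$ the line through them. Points of $\ell^{OI}$ are added and multiplied by the usual constructions. Choose a point $B_1\notin\ell^{OI}$. For the sum, let $P_1$ be the common point of the parallel to $\ell^{OI}$ through $B_1$ and the parallel to $OB_1$ through $A$; then $A+B$ is the common point of $\ell^{OI}$ and the parallel to $BB_1$ through $P_1$. For the product, let $P_1$ be the common point of $OB_1$ and the parallel to $IB_1$ through $A$; then $A\cdot B$ is the common point of $\ell^{OI}$ and the parallel to $BB_1$ through $P_1$. Write $A-B=A+(-B)$, where $B+(-B)=O$, and write $A^{-1}$ for the inverse of a point $A\neq O$ (with $A\cdot A^{-1}=A^{-1}\cdot A=I$). Let $A,B,D\in\ell^{OI}$ be pairwise distinct points, all different from $O$.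 For $X\in\ell^{OI}$, $X\neq B$, put $$f_C(X)=c_r(A,B;X,D)=\left[(A-D)^{-1}(B-D)\right]\left[(B-X)^{-1}(A-X)\right],$$ and let $\mathcal R_4^C=\{f_C(X): X\in\ell^{OI},\ X\neq B\}\subseteq \ell^{OI}$. Then, for the addition of points of $\ell^{OI}$: 1. $(x+y)+z=x+(y+z)$ for all $x,y,z\in\mathcal R_4^C$; 2. $x+y=y+x$ for all $x,y\in\mathcal R_4^C$; 3. $f_C(A)\in\mathcal R_4^C$ is a zero element: $f_C(A)=O$ and $x+f_C(A)=f_C(A)+x=x$ for all $x\in\mathcal R_4^C$. -/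

import Mathlib

/-- Two lines, given as point sets, are parallel if they are equal or have no common point. -/
def LinesParallel {P : Type*} (l m : Set P) : Prop := l = m ∨ l ∩ m = ∅

/-- An affine plane on a type `P` of points; lines are sets of points. -/
structure AffinePlane (P : Type*) where
  /-- the set of lines -/
  lines : Set (Set P)
  /-- two distinct points lie on exactly one line -/
  exists_unique_line : ∀ A B : P, A ≠ B → ∃! l : Set P, l ∈ lines ∧ A ∈ l ∧ B ∈ l
  /-- Playfair's parallel axiom -/
  playfair : ∀ (A : P) (l : Set P), l ∈ lines → A ∉ l →
    ∃! m : Set P, m ∈ lines ∧ A ∈ m ∧ l ∩ m = ∅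
  /-- there are three points that are not collinear -/
  exists_noncollinear : ∃ A B C : P, A ≠ B ∧ A ≠ C ∧ B ≠ C ∧
    ∀ l ∈ lines, ¬ (A ∈ l ∧ B ∈ l ∧ C ∈ l)

namespace AffinePlane

variable {P : Type*} (π : AffinePlane P)

/-- The line through `A` and `B` (used for `A ≠ B` only), as the common part of all lines
through both points. -/
def line (A B : P) : Set P := {X | ∀ l ∈ π.lines, A ∈ l → B ∈ l → X ∈ l}

/-- The line through `A` parallel to the line `l`, as the common part of all such lines. -/
def par (A : P) (l : Set P) : Set P := {X | ∀ m ∈ π.lines, A ∈ m → LinesParallel l m → X ∈ m}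

variable {π}

theorem line_eq {A B : P} (h : A ≠ B) {l : Set P} (hl : l ∈ π.lines) (hA : A ∈ l) (hB : B ∈ l) :
    π.line A B = l := by
  ext X
  refine ⟨fun hX => hX l hl hA hB, fun hX m hm hA' hB' => ?_⟩
  rwa [(π.exists_unique_line A B h).unique ⟨hm, hA', hB'⟩ ⟨hl, hA, hB⟩]

theorem line_mem {A B : P} (h : A ≠ B) : π.line A B ∈ π.lines := by
  obtain ⟨l, ⟨hl, hA, hB⟩, -⟩ := π.exists_unique_line A B h
  rwa [line_eq h hl hA hB]

theorem left_mem_line (A B : P) : A ∈ π.line A B := fun _ _ h _ => h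

theorem right_mem_line (A B : P) : B ∈ π.line A B := fun _ _ _ h => h

theorem parallel_symm {l m : Set P} (h : LinesParallel l m) : LinesParallel m l := by
  rcases h with h | h
  · exact Or.inl h.symm
  · exact Or.inr (by rwa [Set.inter_comm])

theorem eq_of_parallel {l m n : Set P} (hl : l ∈ π.lines) (hm : m ∈ π.lines) (hn : n ∈ π.lines)
    {A : P} (hAm : A ∈ m) (hAn : A ∈ n) (h1 : LinesParallel l m) (h2 : LinesParallel l n) :
    m = n := by
  by_cases hA : A ∈ l
  · have e : ∀ k : Set P, A ∈ k → LinesParallel l k → l = k := by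
      intro k hk h
      rcases h with h | h
      · exact h
      · exact absurd (h ▸ (⟨hA, hk⟩ : A ∈ l ∩ k)) (Set.notMem_empty A)
    rw [← e m hAm h1, ← e n hAn h2]
  · have e : ∀ k : Set P, A ∈ k → LinesParallel l k → l ∩ k = ∅ := by
      intro k hk h
      rcases h with h | h
      · exact absurd (h ▸ hk) hA
      · exact h
    exact (π.playfair A l hl hA).unique ⟨hm, hAm, e m hAm h1⟩ ⟨hn, hAn, e n hAn h2⟩

theorem parallel_trans {l m n : Set P} (hl : l ∈ π.lines) (hm : m ∈ π.lines) (hn : n ∈ π.lines)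
    (h1 : LinesParallel l m) (h2 : LinesParallel m n) : LinesParallel l n := by
  by_cases h : l ∩ n = ∅
  · exact Or.inr h
  · obtain ⟨A, hAl, hAn⟩ := Set.nonempty_iff_ne_empty.mpr h
    exact Or.inl (eq_of_parallel hm hl hn hAl hAn (parallel_symm h1) h2)

theorem par_eq {A : P} {l m : Set P} (hl : l ∈ π.lines) (hm : m ∈ π.lines) (hA : A ∈ m)
    (h : LinesParallel l m) : π.par A l = m := by
  ext X
  refine ⟨fun hX => hX m hm hA h, fun hX n hn hA' h' => ?_⟩
  rwa [eq_of_parallel hl hn hm hA' hA h' h]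

theorem par_spec (A : P) {l : Set P} (hl : l ∈ π.lines) :
    π.par A l ∈ π.lines ∧ A ∈ π.par A l ∧ LinesParallel l (π.par A l) := by
  by_cases hA : A ∈ l
  · rw [par_eq hl hl hA (Or.inl rfl)]
    exact ⟨hl, hA, Or.inl rfl⟩
  · obtain ⟨m, ⟨hm, hAm, h⟩, -⟩ := π.playfair A l hl hA
    rw [par_eq hl hm hAm (Or.inr h)]
    exact ⟨hm, hAm, Or.inr h⟩

theorem exists_notMem {l : Set P} (hl : l ∈ π.lines) : ∃ X : P, X ∉ l := by
  obtain ⟨A, B, C, -, -, -, h⟩ := π.exists_noncollinear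
  by_contra! hX
  exact h l hl ⟨hX A, hX B, hX C⟩

theorem exists_meet {l m : Set P} (h : ¬ LinesParallel l m) : ∃ X : P, X ∈ l ∧ X ∈ m :=
  Set.nonempty_iff_ne_empty.mpr fun h' => h (Or.inr h')

theorem not_parallel_of_common {l m : Set P} {X Y : P} (hX : X ∈ l) (hX' : X ∈ m)
    (hY : Y ∉ l) (hY' : Y ∈ m) : ¬ LinesParallel l m := by
  rintro (h | h)
  · exact hY (h ▸ hY')
  · exact absurd (h ▸ (⟨hX, hX'⟩ : X ∈ l ∩ m)) (Set.notMem_empty X)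

/-- `C = A + B` on the line `OI`: for an auxiliary point `B₁` off the line `OI`, let `P₁` be the
common point of the parallel to `OI` through `B₁` and the parallel to `OB₁` through `A`; then `C`
is the common point of `OI` and the parallel to `BB₁` through `P₁`. -/
def IsSum (π : AffinePlane P) (O I A B C : P) : Prop :=
  ∃ B₁ P₁ : P, B₁ ∉ π.line O I ∧
    (P₁ ∈ π.par B₁ (π.line O I) ∧ P₁ ∈ π.par A (π.line O B₁)) ∧
    (C ∈ π.par P₁ (π.line B B₁) ∧ C ∈ π.line O I)

/-- `C = A · B` on the line `OI`: for an auxiliary point `B₁` off the line `OI`, let `P₁` be the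
common point of the parallel to `IB₁` through `A` and the line `OB₁`; then `C` is the common point
of `OI` and the parallel to `BB₁` through `P₁`. -/
def IsProd (π : AffinePlane P) (O I A B C : P) : Prop :=
  ∃ B₁ P₁ : P, B₁ ∉ π.line O I ∧
    (P₁ ∈ π.par A (π.line I B₁) ∧ P₁ ∈ π.line O B₁) ∧
    (C ∈ π.par P₁ (π.line B B₁) ∧ C ∈ π.line O I)

theorem exists_third {O I B B₁ : P} (hO : O ≠ I) (hB : B ∈ π.line O I)
    (hB₁ : B₁ ∉ π.line O I) (P₁ : P) :
    ∃ C : P, C ∈ π.par P₁ (π.line B B₁) ∧ C ∈ π.line O I := by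
  have hne : B ≠ B₁ := fun h => hB₁ (h ▸ hB)
  have hl := line_mem (π := π) hO
  have hm := line_mem (π := π) hne
  obtain ⟨h1, -, h3⟩ := par_spec P₁ hm
  refine exists_meet fun h => ?_
  exact not_parallel_of_common hB (left_mem_line B B₁) hB₁ (right_mem_line B B₁)
    (parallel_symm (parallel_trans hm h1 hl h3 h))

theorem exists_sum_aux {O I A B₁ : P} (hO : O ≠ I) (hB₁ : B₁ ∉ π.line O I) :
    ∃ P₁ : P, P₁ ∈ π.par B₁ (π.line O I) ∧ P₁ ∈ π.par A (π.line O B₁) := by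
  have hne : O ≠ B₁ := fun h => hB₁ (h ▸ left_mem_line O I)
  have hl := line_mem (π := π) hO
  have hm := line_mem (π := π) hne
  obtain ⟨h1, -, h3⟩ := par_spec B₁ hl
  obtain ⟨k1, -, k3⟩ := par_spec A hm
  refine exists_meet fun h => ?_
  exact not_parallel_of_common (left_mem_line O I) (left_mem_line O B₁) hB₁ (right_mem_line O B₁)
    (parallel_trans hl k1 hm (parallel_trans hl h1 k1 h3 h) (parallel_symm k3))

theorem exists_isSum {O I : P} (hO : O ≠ I) (A : P) {B : P} (hB : B ∈ π.line O I) :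
    ∃ C : π.line O I, π.IsSum O I A B C := by
  obtain ⟨B₁, hB₁⟩ := exists_notMem (line_mem (π := π) hO)
  obtain ⟨P₁, h⟩ := exists_sum_aux (A := A) hO hB₁
  obtain ⟨C, hC⟩ := exists_third hO hB hB₁ P₁
  exact ⟨⟨C, hC.2⟩, B₁, P₁, hB₁, h, hC⟩

theorem exists_isProd {O I : P} (hO : O ≠ I) (A : P) {B : P} (hB : B ∈ π.line O I) :
    ∃ C : π.line O I, π.IsProd O I A B C := by
  obtain ⟨B₁, hB₁⟩ := exists_notMem (line_mem (π := π) hO)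
  have hne : O ≠ B₁ := fun h => hB₁ (h ▸ left_mem_line O I)
  have hne' : I ≠ B₁ := fun h => hB₁ (h ▸ right_mem_line O I)
  have hl := line_mem (π := π) hO
  have hm := line_mem (π := π) hne
  have hm' := line_mem (π := π) hne'
  have hI : I ∉ π.line O B₁ := fun h =>
    hB₁ ((line_eq hO hm (left_mem_line O B₁) h).symm ▸ right_mem_line O B₁)
  obtain ⟨k1, -, k3⟩ := par_spec A hm'
  obtain ⟨P₁, h⟩ : ∃ X : P, X ∈ π.par A (π.line I B₁) ∧ X ∈ π.line O B₁ := by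
    refine exists_meet fun h => ?_
    exact not_parallel_of_common (right_mem_line O B₁) (right_mem_line I B₁) hI
      (left_mem_line I B₁) (parallel_symm (parallel_trans hm' k1 hm k3 h))
  obtain ⟨C, hC⟩ := exists_third hO hB hB₁ P₁
  exact ⟨⟨C, hC.2⟩, B₁, P₁, hB₁, h, hC⟩

theorem exists_isNeg {O I : P} (hO : O ≠ I) (A : P) :
    ∃ N : π.line O I, π.IsSum O I A N O := by
  have hl := line_mem (π := π) hO
  obtain ⟨B₁, hB₁⟩ := exists_notMem hl
  obtain ⟨P₁, h⟩ := exists_sum_aux (A := A) hO hB₁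
  obtain ⟨h1, h2, h3⟩ := par_spec B₁ hl
  have hP : P₁ ∉ π.line O I := by
    intro hP
    rcases h3 with h3 | h3
    · exact hB₁ (h3 ▸ h2)
    · exact absurd (h3 ▸ (⟨hP, h.1⟩ : P₁ ∈ π.line O I ∩ _)) (Set.notMem_empty P₁)
  have hne : O ≠ P₁ := fun h => hP (h ▸ left_mem_line O I)
  have hm := line_mem (π := π) hne
  obtain ⟨k1, k2, k3⟩ := par_spec B₁ hm
  obtain ⟨N, hN, hN'⟩ : ∃ X : P, X ∈ π.par B₁ (π.line O P₁) ∧ X ∈ π.line O I := by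
    refine exists_meet fun h => ?_
    exact not_parallel_of_common (left_mem_line O I) (left_mem_line O P₁) hP
      (right_mem_line O P₁) (parallel_symm (parallel_trans hm k1 hl k3 h))
  have hNB : N ≠ B₁ := fun h => hB₁ (h ▸ hN')
  refine ⟨⟨N, hN'⟩, B₁, P₁, hB₁, h, ?_, left_mem_line O I⟩
  change O ∈ π.par P₁ (π.line N B₁)
  rw [line_eq hNB k1 hN k2, par_eq k1 hm (right_mem_line O P₁) (parallel_symm k3)]
  exact left_mem_line O P₁

end AffinePlane

/-- A Desargues affine plane: an affine plane in which the affine Desargues axiom holds, both for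
three parallel lines `AA'`, `BB'`, `CC'` and for three lines through one point. -/
structure DesarguesPlane (P : Type*) extends AffinePlane P where
  desargues : ∀ A B C A' B' C' : P,
    A ≠ A' → B ≠ B' → C ≠ C' →
    A ≠ B → B ≠ C → A ≠ C → A' ≠ B' → B' ≠ C' → A' ≠ C' →
    toAffinePlane.line A A' ≠ toAffinePlane.line B B' →
    toAffinePlane.line B B' ≠ toAffinePlane.line C C' →
    toAffinePlane.line A A' ≠ toAffinePlane.line C C' →
    ((LinesParallel (toAffinePlane.line A A') (toAffinePlane.line B B') ∧
        LinesParallel (toAffinePlane.line B B') (toAffinePlane.line C C')) ∨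
      ∃ S : P, S ∈ toAffinePlane.line A A' ∧ S ∈ toAffinePlane.line B B' ∧
        S ∈ toAffinePlane.line C C') →
    LinesParallel (toAffinePlane.line A B) (toAffinePlane.line A' B') →
    LinesParallel (toAffinePlane.line B C) (toAffinePlane.line B' C') →
    LinesParallel (toAffinePlane.line A C) (toAffinePlane.line A' C')

/-- A Desargues affine plane with two distinct points `O` and `I` marked in it. -/
structure MarkedPlane (P : Type*) extends DesarguesPlane P where
  O : P
  I : P
  O_ne_I : O ≠ I

noncomputable section

namespace MarkedPlane

variable {P : Type*} (π : MarkedPlane P)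

/-- The points of the line `OI`. -/
abbrev Pt : Type _ := ↥(π.line π.O π.I)

/-- The point `O` of the line `OI`. -/
def zero : π.Pt := ⟨π.O, AffinePlane.left_mem_line _ _⟩

/-- The point `I` of the line `OI`. -/
def one : π.Pt := ⟨π.I, AffinePlane.right_mem_line _ _⟩

variable {π}

/-- Addition of points of the line `OI`. -/
def add (A B : π.Pt) : π.Pt := (AffinePlane.exists_isSum π.O_ne_I A.1 B.2).choose

/-- Multiplication of points of the line `OI`. -/
def mul (A B : π.Pt) : π.Pt := (AffinePlane.exists_isProd π.O_ne_I A.1 B.2).choose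

/-- `-A`: the point with `A + (-A) = O`. -/
def neg (A : π.Pt) : π.Pt := (AffinePlane.exists_isNeg (π := π.toAffinePlane) π.O_ne_I A.1).choose

open Classical in
/-- `A⁻¹` for `A ≠ O`: the point with `A · A⁻¹ = I = A⁻¹ · A`. (It does not exist for `A = O`,
where the value `O` is a mere convention.) -/
def inv (A : π.Pt) : π.Pt :=
  if h : ∃ N : π.Pt, π.IsProd π.O π.I A N π.I ∧ π.IsProd π.O π.I N A π.I then h.choose else π.zero

instance : Zero π.Pt := ⟨π.zero⟩
instance : One π.Pt := ⟨π.one⟩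
instance : Add π.Pt := ⟨add⟩
instance : Mul π.Pt := ⟨mul⟩
instance : Neg π.Pt := ⟨neg⟩
instance : Sub π.Pt := ⟨fun A B => A + -B⟩
instance : Inv π.Pt := ⟨inv⟩

/-- The cross ratio `c_r(A, B; C, D)`, meaningful for `A ≠ D` and `B ≠ C`. -/
def crossRatio (A B C D : π.Pt) : π.Pt := ((A - D)⁻¹ * (B - D)) * ((B - C)⁻¹ * (A - C))

/-- The map `f_C`, `X ↦ c_r(A, B; X, D)`, meaningful for `A ≠ D` and `X ≠ B`. -/
def fC (A B D X : π.Pt) : π.Pt := crossRatio A B X D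

/-- The set of the cross ratios `c_r(A, B; X, D)`, where `X` runs through the points of the line
`OI` for which this cross ratio is defined, that is, `X ≠ B`. -/
def crossRatioSetC (A B D : π.Pt) : Set π.Pt := {x | ∃ X : π.Pt, X ≠ B ∧ x = fC A B D X}

end MarkedPlane

end

/-! The identities hold for all points of the line `OI`; the cross ratios enter only through `f_C(A)
= O`, which follows from `A - A = O` and `X · O = O`. Write `(A, B) ~ (C, D)` if one translation
along the line takes `A` to `B` and `C` to `D`, as witnessed by one auxiliary pair `R, R'` off the
line. Then `A + B = C` means `(O, A) ~ (B, C)` (`isSum_iff_equipollent`). The parallel case of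
Desargues makes the relation independent of `R` (`transports_of_transports`), so it is transitive
and determines its fourth point. It also gives the exchange rule that `(A, B) ~ (C, D)` implies `(A,
C) ~ (B, D)` (`equipollent_swap`). Commutativity is this rule for `A = O`; associativity combines it
with transitivity. Independence of `R` needs a third parallel to the line, hence three points on the
line; the distinct points `A, B, D` provide them. -/

namespace AffinePlane

variable {P : Type*} {π : AffinePlane P}

/-! ### Incidence and parallelism. -/

theorem line_comm (A B : P) : π.line A B = π.line B A := by
  ext X
  exact ⟨fun h l hl hB hA => h l hl hA hB, fun h l hl hA hB => h l hl hB hA⟩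

theorem eq_of_mem_of_mem {l m : Set P} (hl : l ∈ π.lines) (hm : m ∈ π.lines) (h : l ≠ m)
    {X Y : P} (hXl : X ∈ l) (hXm : X ∈ m) (hYl : Y ∈ l) (hYm : Y ∈ m) : X = Y := by
  by_contra hXY
  exact h ((line_eq hXY hl hXl hYl).symm.trans (line_eq hXY hm hXm hYm))

theorem notMem_of_parallel {l m : Set P} (h : LinesParallel l m) (hne : l ≠ m) {X : P}
    (hX : X ∈ l) : X ∉ m := by
  intro hX'
  rcases h with h | h
  · exact hne h
  · exact absurd (h ▸ (⟨hX, hX'⟩ : X ∈ l ∩ m)) (Set.notMem_empty X)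

theorem eq_of_parallel_of_mem {l m : Set P} (h : LinesParallel l m) {X : P}
    (hX : X ∈ l) (hX' : X ∈ m) : l = m :=
  by_contra fun hne => notMem_of_parallel h hne hX hX'

theorem mem_par_iff {l : Set P} (hl : l ∈ π.lines) {A X : P} (h : A ≠ X) :
    X ∈ π.par A l ↔ LinesParallel l (π.line A X) := by
  obtain ⟨h1, h2, h3⟩ := par_spec A hl
  constructor
  · intro hX
    rwa [line_eq h h1 h2 hX]
  · intro hX
    rw [par_eq hl (line_mem h) (left_mem_line A X) hX]
    exact right_mem_line A X

theorem par_ne {l : Set P} (hl : l ∈ π.lines) {A : P} (hA : A ∉ l) : l ≠ π.par A l :=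
  fun h => hA (h ▸ (par_spec A hl).2.1)

theorem notMem_of_mem_par {l : Set P} (hl : l ∈ π.lines) {A X : P} (hA : A ∉ l)
    (hX : X ∈ π.par A l) : X ∉ l :=
  notMem_of_parallel (parallel_symm (par_spec A hl).2.2) (par_ne hl hA).symm hX

theorem line_ne_of_notMem {l : Set P} {A R : P} (hR : R ∉ l) : π.line A R ≠ l :=
  fun h => hR (h ▸ right_mem_line A R)

theorem ne_of_mem_of_notMem' {l : Set P} {A R : P} (hA : A ∈ l) (hR : R ∉ l) : A ≠ R :=
  fun h => hR (h ▸ hA)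

/-- A line with three points and a line parallel to it do not cover the plane. -/
theorem exists_notMem_notMem {l m : Set P} (hl : l ∈ π.lines) (hm : m ∈ π.lines)
    (hlm : LinesParallel l m) (hne : l ≠ m) {X Y Z : P} (hX : X ∈ l) (hY : Y ∈ l) (hZ : Z ∈ l)
    (hXY : X ≠ Y) (hXZ : X ≠ Z) (hYZ : Y ≠ Z) {R : P} (hR : R ∈ m) :
    ∃ T : P, T ∉ l ∧ T ∉ m := by
  have hRl : R ∉ l := notMem_of_parallel (parallel_symm hlm) hne.symm hR
  have hYR := ne_of_mem_of_notMem' hY hRl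
  have hZR := ne_of_mem_of_notMem' hZ hRl
  have kY := line_mem (π := π) hYR
  have kZ := line_mem (π := π) hZR
  obtain ⟨h1, h2, h3⟩ := par_spec X kY
  have hZY : Z ∉ π.line Y R := fun h =>
    hYZ (eq_of_mem_of_mem kY hl (line_ne_of_notMem hRl) (left_mem_line Y R) hY h hZ)
  have hXn : X ∉ π.line Y R := fun h =>
    hXY (eq_of_mem_of_mem kY hl (line_ne_of_notMem hRl) h hX (left_mem_line Y R) hY)
  -- The lines `l` and `ZR` meet only in `Z`, and `m` and `ZR` only in `R`; the parallel to `YR`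
  -- through `X` contains neither `Z` nor `R`.
  obtain ⟨T, hT, hT'⟩ : ∃ T, T ∈ π.par X (π.line Y R) ∧ T ∈ π.line Z R := by
    refine exists_meet fun h => ?_
    exact not_parallel_of_common (right_mem_line Y R) (right_mem_line Z R) hZY
      (left_mem_line Z R) (parallel_trans kY h1 kZ h3 h)
  refine ⟨T, fun hTl => ?_, fun hTm => ?_⟩
  · have e1 : T = Z := eq_of_mem_of_mem kZ hl (line_ne_of_notMem hRl) hT' hTl (left_mem_line Z R) hZ
    have hpl : π.par X (π.line Y R) ≠ l := by
      intro h
      rw [h] at h3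
      exact notMem_of_parallel h3 (line_ne_of_notMem hRl) (left_mem_line Y R) hY
    exact hXZ ((eq_of_mem_of_mem h1 hl hpl h2 hX hT hTl).trans e1)
  · have hZm : Z ∉ m := notMem_of_parallel hlm hne hZ
    have e1 : T = R := eq_of_mem_of_mem kZ hm (fun h => hZm (h ▸ left_mem_line Z R)) hT' hTm
      (right_mem_line Z R) hR
    rw [e1] at hT
    rw [← eq_of_parallel_of_mem h3 (right_mem_line Y R) hT] at h2
    exact hXn h2

/-! ### Translations along a line and equipollence. -/

/-- The translation along the line `l` that takes the point `A` of `l` to the point `B` of `l`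
takes the point `R` off `l` to `R'`. -/
structure Transports (π : AffinePlane P) (l : Set P) (A B R R' : P) : Prop where
  left : A ∈ l
  right : B ∈ l
  notMem : R ∉ l
  mem_par : R' ∈ π.par R l
  parallel : LinesParallel (π.line A R) (π.line B R')

/-- `(A, B)` and `(C, D)` are equipollent pairs of points of the line `l`. -/
def Equipollent (π : AffinePlane P) (l : Set P) (A B C D : P) : Prop :=
  ∃ R R' : P, π.Transports l A B R R' ∧ π.Transports l C D R R'

namespace Transports

variable {l : Set P} {A B C R R' S : P}

theorem notMem' (hl : l ∈ π.lines) (h : π.Transports l A B R R') : R' ∉ l :=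
  notMem_of_mem_par hl h.notMem h.mem_par

theorem line_mem_left (h : π.Transports l A B R R') : π.line A R ∈ π.lines :=
  line_mem (ne_of_mem_of_notMem' h.left h.notMem)

theorem line_mem_right (hl : l ∈ π.lines) (h : π.Transports l A B R R') :
    π.line B R' ∈ π.lines :=
  line_mem (ne_of_mem_of_notMem' h.right (h.notMem' hl))

theorem eq_image (hl : l ∈ π.lines) (h : π.Transports l A B R R') (h' : π.Transports l A B R S) :
    R' = S := by
  have e := eq_of_parallel h.line_mem_left (h.line_mem_right hl) (h'.line_mem_right hl)
    (left_mem_line B R') (left_mem_line B S) h.parallel h'.parallel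
  have hp := par_spec R hl
  refine eq_of_mem_of_mem hp.1 (h.line_mem_right hl) (fun k => ?_) h.mem_par (right_mem_line B R')
    h'.mem_par (e ▸ right_mem_line B S)
  exact notMem_of_parallel hp.2.2 (par_ne hl h.notMem) h.right (k ▸ left_mem_line B R')

theorem eq_right (hl : l ∈ π.lines) (h : π.Transports l A B R R')
    (h' : π.Transports l A C R R') : B = C := by
  have e := eq_of_parallel h.line_mem_left (h.line_mem_right hl) (h'.line_mem_right hl)
    (right_mem_line B R') (right_mem_line C R') h.parallel h'.parallel
  exact eq_of_mem_of_mem (h.line_mem_right hl) hl (line_ne_of_notMem (h.notMem' hl))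
    (left_mem_line B R') h.right (e ▸ left_mem_line C R') h'.right

theorem refl (hl : l ∈ π.lines) (hA : A ∈ l) (hR : R ∉ l) : π.Transports l A A R R :=
  ⟨hA, hA, hR, (par_spec R hl).2.1, Or.inl rfl⟩

theorem eq_iff (hl : l ∈ π.lines) (h : π.Transports l A B R R') : A = B ↔ R = R' := by
  constructor
  · rintro rfl
    exact (refl hl h.left h.notMem).eq_image hl h
  · rintro rfl
    exact (refl hl h.left h.notMem).eq_right hl h

theorem exists_image (hl : l ∈ π.lines) (hA : A ∈ l) (hB : B ∈ l) (hR : R ∉ l) :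
    ∃ R', π.Transports l A B R R' := by
  have hAR := ne_of_mem_of_notMem' hA hR
  have hm := line_mem (π := π) hAR
  obtain ⟨h1, h2, h3⟩ := par_spec R hl
  obtain ⟨k1, k2, k3⟩ := par_spec B hm
  obtain ⟨X, hX, hX'⟩ : ∃ X, X ∈ π.par R l ∧ X ∈ π.par B (π.line A R) := by
    refine exists_meet fun h => ?_
    exact not_parallel_of_common hA (left_mem_line A R) hR (right_mem_line A R)
      (parallel_trans hl k1 hm (parallel_trans hl h1 k1 h3 h) (parallel_symm k3))
  have hXl := notMem_of_mem_par hl hR hX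
  exact ⟨X, hA, hB, hR, hX, (mem_par_iff hm (ne_of_mem_of_notMem' hB hXl)).1 hX'⟩

end Transports

/-- The points `B₁`, `P₁` of the sum construction serve as `R`, `R'`, so this is a reformulation
that needs no Desargues axiom. -/
theorem isSum_iff_equipollent {O I A B C : P} (hO : O ≠ I) (hA : A ∈ π.line O I)
    (hB : B ∈ π.line O I) :
    π.IsSum O I A B C ↔ π.Equipollent (π.line O I) O A B C := by
  have hl := line_mem (π := π) hO
  constructor
  · rintro ⟨R, R', hR, ⟨h1, h2⟩, h3, h4⟩
    have hR' := notMem_of_mem_par hl hR h1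
    refine ⟨R, R', ⟨left_mem_line O I, hA, hR, h1, ?_⟩, ⟨hB, h4, hR, h1, ?_⟩⟩
    · exact (mem_par_iff (line_mem (ne_of_mem_of_notMem' (left_mem_line O I) hR))
        (ne_of_mem_of_notMem' hA hR')).1 h2
    · rw [line_comm C R']
      exact (mem_par_iff (line_mem (ne_of_mem_of_notMem' hB hR))
        (ne_of_mem_of_notMem' h4 hR').symm).1 h3
  · rintro ⟨R, R', h, h'⟩
    refine ⟨R, R', h.notMem, ⟨h.mem_par, ?_⟩, ?_, h'.right⟩
    · exact (mem_par_iff h.line_mem_left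
        (ne_of_mem_of_notMem' hA (h.notMem' hl))).2 h.parallel
    · refine (mem_par_iff h'.line_mem_left
        (ne_of_mem_of_notMem' h'.right (h.notMem' hl)).symm).2 ?_
      rw [line_comm R' C]
      exact h'.parallel

/-- For the right factor `O`, the parallel to `OB₁` through `P₁` is `OB₁` itself, whatever `B₁` is,
and it meets `OI` in `O`. -/
theorem IsProd.eq_of_right {O I A C : P} (hO : O ≠ I) (h : π.IsProd O I A O C) : C = O := by
  obtain ⟨R, R', hR, ⟨-, h2⟩, h3, h4⟩ := h
  have hOR := ne_of_mem_of_notMem' (left_mem_line O I) hR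
  have hm := line_mem (π := π) hOR
  rw [par_eq hm hm h2 (Or.inl rfl)] at h3
  exact eq_of_mem_of_mem hm (line_mem hO) (line_ne_of_notMem hR) h3 h4
    (left_mem_line O R) (left_mem_line O I)

end AffinePlane

/-! ### Consequences of the parallel Desargues axiom. -/

namespace DesarguesPlane

open AffinePlane

variable {P : Type*} {π : DesarguesPlane P}

/-- The parallel case of the Desargues axiom, for triangles with vertices on three parallel lines,
the case of equal triangles included. -/
theorem parallel_of_parallel_lines {l m n : Set P} (hl : l ∈ π.lines) (hm : m ∈ π.lines)
    (hn : n ∈ π.lines) (hlm : LinesParallel l m) (hmn : LinesParallel m n) (nlm : l ≠ m)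
    (nmn : m ≠ n) (nln : l ≠ n) {A A' B B' C C' : P} (hA : A ∈ l) (hA' : A' ∈ l) (hB : B ∈ m)
    (hB' : B' ∈ m) (hC : C ∈ n) (hC' : C' ∈ n)
    (h1 : LinesParallel (π.line A B) (π.line A' B'))
    (h2 : LinesParallel (π.line B C) (π.line B' C')) :
    LinesParallel (π.line A C) (π.line A' C') := by
  have hln := parallel_trans hl hm hn hlm hmn
  have d1 : ∀ {X Y}, X ∈ l → Y ∈ m → X ≠ Y := fun hX hY h =>
    notMem_of_parallel hlm nlm hX (h ▸ hY)
  have d2 : ∀ {X Y}, X ∈ m → Y ∈ n → X ≠ Y := fun hX hY h =>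
    notMem_of_parallel hmn nmn hX (h ▸ hY)
  have d3 : ∀ {X Y}, X ∈ l → Y ∈ n → X ≠ Y := fun hX hY h =>
    notMem_of_parallel hln nln hX (h ▸ hY)
  -- if two corresponding vertices agree, so do the neighbouring ones
  have key : ∀ {k j : Set P}, k ∈ π.lines → j ∈ π.lines → k ≠ j → LinesParallel k j →
      ∀ {X X' Y Y'}, X ∈ k → X' ∈ k → Y ∈ j → Y' ∈ j →
      LinesParallel (π.line X Y) (π.line X' Y') → X = X' → Y = Y' := by
    intro k j hk hj hne hp X X' Y Y' hX hX' hY hY' h e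
    subst e
    have hXj := notMem_of_parallel hp hne hX
    have e := eq_of_parallel_of_mem h (left_mem_line X Y) (left_mem_line X Y')
    have hXY : X ≠ Y := fun h => hXj (h ▸ hY)
    refine eq_of_mem_of_mem hj (line_mem hXY) (fun h => hXj (h ▸ left_mem_line X Y)) hY
      (right_mem_line X Y) hY' (e ▸ right_mem_line X Y')
  have h1' : LinesParallel (π.line B A) (π.line B' A') := by
    rwa [line_comm B A, line_comm B' A']
  have h2' : LinesParallel (π.line C B) (π.line C' B') := by
    rwa [line_comm C B, line_comm C' B']
  have eAB : A = A' → B = B' := key hl hm nlm hlm hA hA' hB hB' h1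
  have eBC : B = B' → C = C' := key hm hn nmn hmn hB hB' hC hC' h2
  have eBA : B = B' → A = A' := key hm hl nlm.symm (parallel_symm hlm) hB hB' hA hA' h1'
  have eCB : C = C' → B = B' := key hn hm nmn.symm (parallel_symm hmn) hC hC' hB hB' h2'
  by_cases hBB : B = B'
  · rw [eBA hBB, eBC hBB]
    exact Or.inl rfl
  · have hAA : A ≠ A' := fun h => hBB (eAB h)
    have hCC : C ≠ C' := fun h => hBB (eCB h)
    have e1 := line_eq hAA hl hA hA'
    have e2 := line_eq hBB hm hB hB'
    have e3 := line_eq hCC hn hC hC'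
    refine π.desargues A B C A' B' C' hAA hBB hCC (d1 hA hB) (d2 hB hC) (d3 hA hC) (d1 hA' hB')
      (d2 hB' hC') (d3 hA' hC') ?_ ?_ ?_ (Or.inl ⟨?_, ?_⟩) h1 h2
    · rwa [e1, e2]
    · rwa [e2, e3]
    · rwa [e1, e3]
    · rwa [e1, e2]
    · rwa [e2, e3]

variable {l : Set P} {A B C D R R' S S' : P}

/-- Two applications of Desargues on the distinct parallels `l`, `RR'`, `SS'`: the pair `A, B`
yields `RS ∥ R'S'`, and this with the pair `C, D` yields `CS ∥ DS'`. -/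
theorem transports_of_transports_of_notMem (hl : l ∈ π.lines) (h1 : π.Transports l A B R R')
    (h2 : π.Transports l C D R R') (h3 : π.Transports l A B S S') (hS : S ∉ π.par R l) :
    π.Transports l C D S S' := by
  obtain ⟨hm, hRm, hlm⟩ := par_spec R hl
  obtain ⟨hn, hSn, hln⟩ := par_spec S hl
  have nlm := par_ne hl h1.notMem
  have nln := par_ne hl h3.notMem
  have nmn : π.par R l ≠ π.par S l := fun h => hS (h ▸ hSn)
  have hmn := parallel_trans hm hl hn (parallel_symm hlm) hln
  have k1 := h1.parallel
  rw [line_comm A R, line_comm B R'] at k1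
  have k2 := parallel_of_parallel_lines hm hl hn (parallel_symm hlm) hln nlm.symm nln nmn
    hRm h1.mem_par h1.left h1.right hSn h3.mem_par k1 h3.parallel
  exact ⟨h2.left, h2.right, h3.notMem, h3.mem_par,
    parallel_of_parallel_lines hl hm hn hlm hmn nlm nmn nln
      h2.left h2.right hRm h1.mem_par hSn h3.mem_par h2.parallel k2⟩

/-- The translation along a line with at least three points, taking `A` to `B`, takes `C` to the
same point `D` for all choices of the auxiliary points. -/
theorem transports_of_transports (hl : l ∈ π.lines) {X Y Z : P} (hX : X ∈ l) (hY : Y ∈ l)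
    (hZ : Z ∈ l) (hXY : X ≠ Y) (hXZ : X ≠ Z) (hYZ : Y ≠ Z) (h1 : π.Transports l A B R R')
    (h2 : π.Transports l C D R R') (h3 : π.Transports l A B S S') : π.Transports l C D S S' := by
  -- If `R` and `S` lie on the same parallel to `l`, pass through a point `T` on a third one.
  by_cases hS : S ∈ π.par R l
  · obtain ⟨hm, hRm, hlm⟩ := par_spec R hl
    obtain ⟨T, hTl, hTm⟩ := exists_notMem_notMem hl hm hlm (par_ne hl h1.notMem) hX hY hZ
      hXY hXZ hYZ hRm
    obtain ⟨T', hT⟩ := Transports.exists_image hl h1.left h1.right hTl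
    have h4 := transports_of_transports_of_notMem hl h1 h2 hT hTm
    refine transports_of_transports_of_notMem hl hT h4 h3 fun hST => hTm ?_
    obtain ⟨hn, hTn, hln⟩ := par_spec T hl
    rwa [eq_of_parallel hl hm hn hS hST hlm hln]
  · exact transports_of_transports_of_notMem hl h1 h2 h3 hS

section Equipollent

theorem equipollent_symm (h : π.Equipollent l A B C D) : π.Equipollent l C D A B := by
  obtain ⟨R, R', h1, h2⟩ := h
  exact ⟨R, R', h2, h1⟩

theorem equipollent_refl (hl : l ∈ π.lines) (hA : A ∈ l) (hB : B ∈ l) :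
    π.Equipollent l A B A B := by
  obtain ⟨R, hR⟩ := exists_notMem hl
  obtain ⟨R', h⟩ := Transports.exists_image hl hA hB hR
  exact ⟨R, R', h, h⟩

theorem equipollent_self_self (hl : l ∈ π.lines) (hA : A ∈ l) (hB : B ∈ l) :
    π.Equipollent l A A B B := by
  obtain ⟨R, hR⟩ := exists_notMem hl
  exact ⟨R, R, .refl hl hA hR, .refl hl hB hR⟩

variable {F G X Y Z : P} (hl : l ∈ π.lines) (hX : X ∈ l) (hY : Y ∈ l) (hZ : Z ∈ l) (hXY : X ≠ Y)
  (hXZ : X ≠ Z) (hYZ : Y ≠ Z)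

include hl hX hY hZ hXY hXZ hYZ

theorem equipollent_trans (h : π.Equipollent l A B C D) (h' : π.Equipollent l C D F G) :
    π.Equipollent l A B F G := by
  obtain ⟨R, R', h1, h2⟩ := h
  obtain ⟨S, S', h3, h4⟩ := h'
  exact ⟨R, R', h1, transports_of_transports hl hX hY hZ hXY hXZ hYZ h3 h4 h2⟩

theorem equipollent_unique (h : π.Equipollent l A B C D) (h' : π.Equipollent l A B C F) :
    D = F := by
  obtain ⟨R, R', h1, h2⟩ := h
  obtain ⟨S, S', h3, h4⟩ := h'
  exact h2.eq_right hl (transports_of_transports hl hX hY hZ hXY hXZ hYZ h3 h4 h1)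

/-- The commutativity of the translations along `l`. -/
theorem equipollent_swap (h : π.Equipollent l A B C D) : π.Equipollent l A C B D := by
  obtain ⟨R, R', h1, h2⟩ := h
  have hA := h1.left
  have hB := h1.right
  have hC := h2.left
  have hD := h2.right
  by_cases hAB : A = B
  · have hCD : C = D := (h2.eq_iff hl).2 ((h1.eq_iff hl).1 hAB)
    subst hAB hCD
    exact equipollent_refl hl hA hC
  have hCD : C ≠ D := fun h => hAB ((h1.eq_iff hl).2 ((h2.eq_iff hl).1 h))
  by_cases hAC : A = C
  · subst hAC
    rw [← h1.eq_right hl h2]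
    exact equipollent_self_self hl hA hB
  have hR := h1.notMem
  obtain ⟨hm, hRm, hlm⟩ := par_spec R hl
  have nlm := par_ne hl hR
  obtain ⟨S, hS⟩ := Transports.exists_image hl hA hC hR
  have hSl := hS.notMem' hl
  have hSm := hS.mem_par
  obtain ⟨S', h3⟩ := Transports.exists_image hl hC hD hSl
  -- `S'` is the image of `S` under `C ↦ D`, hence also under `A ↦ B`. It remains to show `BR ∥ DS`.
  have h4 := transports_of_transports hl hX hY hZ hXY hXZ hYZ h2 h1 h3
  have hSm' : S' ∈ π.par R l := by
    rw [← par_eq hl hm hSm hlm]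
    exact h3.mem_par
  refine ⟨R, S, hS, hB, hD, hR, hSm, ?_⟩
  have hRS : R ≠ S := fun h => hAC ((hS.eq_iff hl).2 h)
  have hSS : S ≠ S' := fun h => hCD ((h3.eq_iff hl).2 h)
  have lAR := hS.line_mem_left
  have lCS := h3.line_mem_left
  have lAS := h4.line_mem_left
  have lDS' := h3.line_mem_right hl
  have lBS' := h4.line_mem_right hl
  have mne : ∀ {U V : P}, U ∈ l → π.line U V ≠ π.par R l := fun hU h =>
    notMem_of_parallel hlm nlm hU (h ▸ left_mem_line _ _)
  have hACS : A ∉ π.line C S := fun h =>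
    hAC (eq_of_mem_of_mem lCS hl (line_ne_of_notMem hSl) h hA (left_mem_line C S) hC)
  have hRCS : R ∉ π.line C S := fun h =>
    hRS (eq_of_mem_of_mem lCS hm (mne hC) h hRm (right_mem_line C S) hSm)
  have hRAS : R ∉ π.line A S := fun h =>
    hRS (eq_of_mem_of_mem lAS hm (mne hA) h hRm (right_mem_line A S) hSm)
  have hDCS : D ∉ π.line C S := fun h =>
    hCD (eq_of_mem_of_mem lCS hl (line_ne_of_notMem hSl) (left_mem_line C S) hC h hD)
  have hBAS : B ∉ π.line A S := fun h =>
    hAB (eq_of_mem_of_mem lAS hl (line_ne_of_notMem hSl) (left_mem_line A S) hA h hB)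
  obtain ⟨hp, hRp, hASp⟩ := par_spec R lAS
  -- `W` completes the parallelogram `A, R, W, S`; the line `WS'` will be parallel to both `BR` and
  -- `DS`.
  obtain ⟨W, hWp, hW⟩ : ∃ W, W ∈ π.par R (π.line A S) ∧ W ∈ π.line C S := by
    refine exists_meet fun h => ?_
    exact not_parallel_of_common (right_mem_line C S) (right_mem_line A S) hACS
      (left_mem_line A S)
      (parallel_symm (parallel_trans lAS hp lCS hASp h))
  have hWS : W ≠ S := fun h =>
    notMem_of_mem_par lAS hRAS hWp (by rw [h]; exact right_mem_line A S)
  have hRW : R ≠ W := fun h => hRCS (h ▸ hW)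
  have hWm : W ∉ π.par R l := fun h =>
    hWS (eq_of_mem_of_mem lCS hm (mne hC) hW h (right_mem_line C S) hSm)
  have hWS' : W ≠ S' := fun h => hWm (h ▸ hSm')
  have hBR := ne_of_mem_of_notMem' hB hR
  have eSW : π.line S W = π.line C S := line_eq hWS.symm lCS (right_mem_line C S) hW
  have eRW : π.line R W = π.par R (π.line A S) := line_eq hRW hp hRp hWp
  have eAB : π.line A B = l := line_eq hAB hl hA hB
  have eSS : π.line S S' = π.par R l := line_eq hSS hm hSm hSm'
  -- Desargues for the triangles `R, A, B` and `W, S, S'` on the parallels `RW`, `AS`, `BS'`. If `RW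
  -- = BS'`, then `R, B, W, S'` are collinear.
  have c1 : LinesParallel (π.line R B) (π.line W S') := by
    by_cases hq : π.par R (π.line A S) = π.line B S'
    · left
      rw [line_eq hBR.symm hp hRp (hq ▸ left_mem_line B S'),
        line_eq hWS' hp hWp (hq ▸ right_mem_line B S')]
    · refine parallel_of_parallel_lines hp lAS lBS' (parallel_symm hASp) h4.parallel
        (par_ne lAS hRAS).symm (fun h => hBAS (h ▸ left_mem_line B S')) hq hRp hWp
        (left_mem_line A S) (right_mem_line A S) (left_mem_line B S') (right_mem_line B S') ?_ ?_
      · rw [line_comm R A, line_comm W S, eSW]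
        exact hS.parallel
      · rwa [eAB, eSS]
  -- Desargues for the triangles `W, R, S'` and `S, A, D` on the parallels `CS`, `AR`, `DS'`. If `R
  -- = S'`, then `A = D` and the claim is `RW ∥ AS`.
  have c2 : LinesParallel (π.line W S') (π.line S D) := by
    by_cases hRS' : R = S'
    · have e : A = D := by
        have := eq_of_parallel lCS lAR lDS' (right_mem_line A R)
          (by rw [hRS']; exact right_mem_line D S') (parallel_symm hS.parallel) h3.parallel
        exact eq_of_mem_of_mem lAR hl (line_ne_of_notMem hR) (left_mem_line A R) hA
          (this ▸ left_mem_line D S') hD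
      rw [← hRS', ← e, line_comm W R, line_comm S A, eRW]
      exact parallel_symm hASp
    · have hAD : A ≠ D := by
        intro h
        have h5 : LinesParallel (π.line A R) (π.line A S') := by
          have := parallel_trans lAR lCS lDS' hS.parallel h3.parallel
          rwa [← h] at this
        have e := eq_of_parallel_of_mem h5 (left_mem_line A R) (left_mem_line A S')
        exact hRS' (eq_of_mem_of_mem lAR hm (mne hA) (right_mem_line A R) hRm
          (e ▸ right_mem_line A S') hSm')
      refine parallel_of_parallel_lines (B := R) (B' := A) lCS lAR lDS'
        (parallel_symm hS.parallel)
        (parallel_trans lAR lCS lDS' hS.parallel h3.parallel)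
        (fun h => hACS (h ▸ left_mem_line A R)) ?_ (fun h => hDCS (h ▸ left_mem_line D S'))
        hW (right_mem_line C S) (right_mem_line A R) (left_mem_line A R)
        (right_mem_line D S') (left_mem_line D S') ?_ ?_
      · intro h
        exact hAD (eq_of_mem_of_mem lAR hl (line_ne_of_notMem hR) (left_mem_line A R) hA
          (h ▸ left_mem_line D S') hD)
      · rw [line_comm W R, line_comm S A, eRW]
        exact parallel_symm hASp
      · rw [line_eq hRS' hm hRm hSm', line_eq hAD hl hA hD]
        exact parallel_symm hlm
  have hSD := (ne_of_mem_of_notMem' hD hSl).symm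
  rw [line_comm B R, line_comm D S]
  exact parallel_trans (line_mem hBR.symm) (line_mem hWS') (line_mem hSD) c1 c2

end Equipollent

end DesarguesPlane

/-! ### Arithmetic of the points of `OI`. -/

namespace MarkedPlane

open AffinePlane DesarguesPlane

variable {P : Type*} {π : MarkedPlane P}

theorem line_mem_lines : π.line π.O π.I ∈ π.lines := line_mem π.O_ne_I

theorem isSum_add (A B : π.Pt) : π.IsSum π.O π.I A.1 B.1 (A + B).1 :=
  (exists_isSum π.O_ne_I A.1 B.2).choose_spec

theorem isProd_mul (A B : π.Pt) : π.IsProd π.O π.I A.1 B.1 (A * B).1 :=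
  (exists_isProd π.O_ne_I A.1 B.2).choose_spec

theorem isSum_neg (A : π.Pt) : π.IsSum π.O π.I A.1 (-A).1 (0 : π.Pt).1 :=
  (exists_isNeg (π := π.toAffinePlane) π.O_ne_I A.1).choose_spec

theorem equipollent_add (A B : π.Pt) :
    π.Equipollent (π.line π.O π.I) π.O A.1 B.1 (A + B).1 :=
  (isSum_iff_equipollent π.O_ne_I A.2 B.2).1 (isSum_add A B)

theorem mul_zero (A : π.Pt) : A * 0 = 0 :=
  Subtype.ext ((isProd_mul A 0).eq_of_right π.O_ne_I)

section Add

variable {X Y Z : π.Pt} (hXY : X ≠ Y) (hXZ : X ≠ Z) (hYZ : Y ≠ Z)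

include hXY hXZ hYZ

theorem add_eq_iff {A B C : π.Pt} :
    A + B = C ↔ π.Equipollent (π.line π.O π.I) π.O A.1 B.1 C.1 := by
  refine ⟨fun h => h ▸ equipollent_add A B, fun h => Subtype.ext ?_⟩
  exact equipollent_unique line_mem_lines X.2 Y.2 Z.2 (Subtype.coe_ne_coe.2 hXY)
    (Subtype.coe_ne_coe.2 hXZ) (Subtype.coe_ne_coe.2 hYZ) (equipollent_add A B) h

theorem equipollent_swap_points {A B C D : P}
    (h : π.Equipollent (π.line π.O π.I) A B C D) :
    π.Equipollent (π.line π.O π.I) A C B D :=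
  equipollent_swap line_mem_lines X.2 Y.2 Z.2 (Subtype.coe_ne_coe.2 hXY)
    (Subtype.coe_ne_coe.2 hXZ) (Subtype.coe_ne_coe.2 hYZ) h

theorem equipollent_trans_points {A B C D F G : P}
    (h : π.Equipollent (π.line π.O π.I) A B C D) (h' : π.Equipollent (π.line π.O π.I) C D F G) :
    π.Equipollent (π.line π.O π.I) A B F G :=
  equipollent_trans line_mem_lines X.2 Y.2 Z.2 (Subtype.coe_ne_coe.2 hXY)
    (Subtype.coe_ne_coe.2 hXZ) (Subtype.coe_ne_coe.2 hYZ) h h'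

theorem add_comm (x y : π.Pt) : x + y = y + x :=
  (add_eq_iff hXY hXZ hYZ).2 (equipollent_swap_points hXY hXZ hYZ (equipollent_add y x))

theorem add_assoc (x y z : π.Pt) : (x + y) + z = x + (y + z) := by
  symm
  rw [add_eq_iff hXY hXZ hYZ]
  -- Both `(y, y + z)` and `(x + y, (x + y) + z)` are equipollent to `(O, z)`. Exchanging gives `(y,
  -- x + y) ~ (y + z, (x + y) + z)`, and the first pair is equipollent to `(O, x)`.
  have h1 := equipollent_swap_points hXY hXZ hYZ (equipollent_add y z)
  have h2 := equipollent_swap_points hXY hXZ hYZ (equipollent_add (x + y) z)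
  have h3 := equipollent_swap_points hXY hXZ hYZ
    (equipollent_trans_points hXY hXZ hYZ (equipollent_symm h1) h2)
  exact equipollent_trans_points hXY hXZ hYZ (equipollent_add x y) h3

theorem zero_add (x : π.Pt) : 0 + x = x :=
  (add_eq_iff hXY hXZ hYZ).2
    (equipollent_self_self line_mem_lines (0 : π.Pt).2 x.2)

theorem add_zero (x : π.Pt) : x + 0 = x :=
  (add_eq_iff hXY hXZ hYZ).2 (equipollent_refl line_mem_lines (0 : π.Pt).2 x.2)

theorem sub_self (x : π.Pt) : x - x = 0 :=
  (add_eq_iff hXY hXZ hYZ).2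
    ((isSum_iff_equipollent π.O_ne_I x.2 (-x).2).1 (isSum_neg x))

end Add

end MarkedPlane

theorem theorem2p7 {P : Type*} (π : MarkedPlane P) (A B D : π.Pt)
    (hAB : A ≠ B) (hAD : A ≠ D) (hBD : B ≠ D) (hA : A ≠ 0) (hB : B ≠ 0) (hD : D ≠ 0) :
    (∀ x ∈ MarkedPlane.crossRatioSetC A B D, ∀ y ∈ MarkedPlane.crossRatioSetC A B D,
      ∀ z ∈ MarkedPlane.crossRatioSetC A B D, (x + y) + z = x + (y + z)) ∧
    (∀ x ∈ MarkedPlane.crossRatioSetC A B D, ∀ y ∈ MarkedPlane.crossRatioSetC A B D,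
      x + y = y + x) ∧
    (MarkedPlane.fC A B D A ∈ MarkedPlane.crossRatioSetC A B D ∧
      MarkedPlane.fC A B D A = 0 ∧
      ∀ x ∈ MarkedPlane.crossRatioSetC A B D,
        x + MarkedPlane.fC A B D A = x ∧ MarkedPlane.fC A B D A + x = x) := by
  -- The factor `A - A = O` annihilates both products from the right, so the values of the inverses
  -- play no role.
  have h0 : MarkedPlane.fC A B D A = 0 := by
    unfold MarkedPlane.fC MarkedPlane.crossRatio
    rw [MarkedPlane.sub_self hAB hAD hBD, MarkedPlane.mul_zero, MarkedPlane.mul_zero]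
  refine ⟨fun x _ y _ z _ => MarkedPlane.add_assoc hAB hAD hBD x y z,
    fun x _ y _ => MarkedPlane.add_comm hAB hAD hBD x y, ⟨A, hAB, rfl⟩, h0, fun x _ => ?_⟩
  rw [h0]
  exact ⟨MarkedPlane.add_zero hAB hAD hBD x, MarkedPlane.zero_add hAB hAD hBD x⟩
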